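/- Let $\Gamma$ be a finitely generated residually finite group, let $1\to H\to\Gamma\to G\to 1$ be a group extension, and let $K_0\supseteq K_1\supseteq K_2\supseteq\cdots$ be a nested sequence of finite-index normal subgroups of $\Gamma$ with trivial intersection. Regard $H$ as a normal subgroup of $\Gamma$, and let $L=\bigcap_i HK_i/H$, a normal subgroup of $G\cong\Gamma/H$. Fix a finite generating set $S$ of $\Gamma$ and real numbers $a_i$ that are greater than the diameters of both $\Gamma/K_i$ and $\Gamma/K_{i+1}$, where every quotient $\Gamma/K_i$ carries the word metric $d_i$ with respect to the image of $S$. The box space $\Box_{\{K_i\}}\Gamma$ is the disjoint union $\bigsqcup_i\Gamma/K_i$ with the metric that is $d_i$ on $\Gamma/K_i$ and is given by $$d(\alpha,\beta)=d_i(\alpha,e_i)+\sum_{k=i}^{j-1}a_k+d_j(e_j,\beta)\qquad(\alpha\in\Gamma/K_i,\ \beta\in\Gamma/K_j,\ i<j),$$ where $e_i$ is the identity element of $\Gamma/K_i$. The box space $\Box_{\{H\cap K_i\}}H=\bigsqcup_i H/(H\cap K_i)$ carries the metric induced from $\Box_{\{K_i\}}\Gamma$ through the inclusions $H/(H\cap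 K_i)\cong HK_i/K_i\subseteq\Gamma/K_i$. A metric space $X$ coarsely embeds into Hilbert space if there are a map $F:X\to\ell^2(\mathbb N)$ and non-decreasing functions $\rho_\pm:[0,\infty)\to[0,\infty)$ tending to $\infty$ at $\infty$ such that $\rho_-(d(x,x'))\le\|F(x)-F(x')\|\le\rho_+(d(x,x'))$ for all $x,x'\in X$. If the group $G/L$ is amenable and $\Box_{\{H\cap K_i\}}H$, with the induced metric, coarsely embeds into Hilbert space, then $\Box_{\{K_i\}}\Gamma$ coarsely embeds into Hilbert space. -/

import Mathlib

open scoped NNReal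

namespace BoxSpaces

section WordMetric

variable {Q : Type*} [Group Q]

/-- `w` is a word in the letters `S ∪ S⁻¹`. -/
def IsWord (S : Set Q) (w : List Q) : Prop := ∀ s ∈ w, s ∈ S ∨ s⁻¹ ∈ S

/-- The word length of `q` with respect to `S`: the least length of a word in `S ∪ S⁻¹` with
product `q` (used only when `S` generates the group). -/
noncomputable def wordLength (S : Set Q) (q : Q) : ℕ :=
  sInf {n : ℕ | ∃ w : List Q, IsWord S w ∧ w.prod = q ∧ w.length = n}

/-- The left-invariant word metric with respect to `S`. -/
noncomputable def wordDist (S : Set Q) (x y : Q) : ℕ := wordLength S (x⁻¹ * y)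

theorem exists_word {S : Set Q} (hS : Subgroup.closure S = ⊤) (q : Q) :
    ∃ w : List Q, IsWord S w ∧ w.prod = q ∧ w.length = wordLength S q := by
  have hne : {n : ℕ | ∃ w : List Q, IsWord S w ∧ w.prod = q ∧ w.length = n}.Nonempty := by
    have hq : q ∈ Subgroup.closure S := hS ▸ Subgroup.mem_top q
    rw [← Subgroup.mem_toSubmonoid, Subgroup.closure_toSubmonoid] at hq
    obtain ⟨w, hw, hp⟩ := Submonoid.exists_list_of_mem_closure hq
    exact ⟨w.length, w, hw, hp, rfl⟩
  exact Nat.sInf_mem hne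

theorem wordLength_le {S : Set Q} {w : List Q} (hw : IsWord S w) :
    wordLength S w.prod ≤ w.length :=
  Nat.sInf_le ⟨w, hw, rfl, rfl⟩

theorem wordLength_one (S : Set Q) : wordLength S 1 = 0 := by
  simpa using wordLength_le (S := S) (w := []) (by simp [IsWord])

theorem wordLength_mul_le {S : Set Q} (hS : Subgroup.closure S = ⊤) (x y : Q) :
    wordLength S (x * y) ≤ wordLength S x + wordLength S y := by
  obtain ⟨v, hv, hvx, hvl⟩ := exists_word hS x
  obtain ⟨w, hw, hwy, hwl⟩ := exists_word hS y
  have h : IsWord S (v ++ w) := by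
    intro s hs
    rcases List.mem_append.1 hs with h | h
    · exact hv s h
    · exact hw s h
  have := wordLength_le h
  rw [List.prod_append, hvx, hwy, List.length_append] at this
  omega

theorem wordLength_inv_le {S : Set Q} (hS : Subgroup.closure S = ⊤) (x : Q) :
    wordLength S x⁻¹ ≤ wordLength S x := by
  obtain ⟨w, hw, hwx, hwl⟩ := exists_word hS x
  have h : IsWord S (w.map fun s => s⁻¹).reverse := by
    intro s hs
    simp only [List.mem_reverse, List.mem_map] at hs
    obtain ⟨t, ht, rfl⟩ := hs
    rw [inv_inv]
    exact (hw t ht).symm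
  have := wordLength_le h
  rw [← List.prod_inv_reverse, hwx, List.length_reverse, List.length_map] at this
  omega

theorem wordLength_inv {S : Set Q} (hS : Subgroup.closure S = ⊤) (x : Q) :
    wordLength S x⁻¹ = wordLength S x :=
  le_antisymm (wordLength_inv_le hS x) (by simpa using wordLength_inv_le hS x⁻¹)

theorem eq_one_of_wordLength {S : Set Q} (hS : Subgroup.closure S = ⊤) {x : Q}
    (hx : wordLength S x = 0) : x = 1 := by
  obtain ⟨w, -, hwx, hwl⟩ := exists_word hS x
  rw [hx, List.length_eq_zero_iff] at hwl
  simpa [hwl] using hwx.symm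

theorem wordDist_self (S : Set Q) (x : Q) : wordDist S x x = 0 := by
  simp [wordDist, wordLength_one]

theorem wordDist_comm {S : Set Q} (hS : Subgroup.closure S = ⊤) (x y : Q) :
    wordDist S x y = wordDist S y x := by
  rw [wordDist, wordDist, ← wordLength_inv hS, mul_inv_rev, inv_inv]

theorem wordDist_triangle {S : Set Q} (hS : Subgroup.closure S = ⊤) (x y z : Q) :
    wordDist S x z ≤ wordDist S x y + wordDist S y z := by
  have := wordLength_mul_le hS (x⁻¹ * y) (y⁻¹ * z)
  rwa [mul_assoc, mul_inv_cancel_left] at this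

theorem eq_of_wordDist {S : Set Q} (hS : Subgroup.closure S = ⊤) {x y : Q}
    (h : wordDist S x y = 0) : x = y :=
  inv_mul_eq_one.1 (eq_one_of_wordLength hS h)

end WordMetric

section Box

variable {Γ : Type*} [Group Γ]

/-- The image of the set `S` in the quotient `Γ ⧸ N`. -/
def quotGen (S : Set Γ) (N : Subgroup Γ) : Set (Γ ⧸ N) := (fun g : Γ => (g : Γ ⧸ N)) '' S

theorem closure_quotGen {S : Set Γ} (hS : Subgroup.closure S = ⊤) (N : Subgroup Γ) [N.Normal] :
    Subgroup.closure (quotGen S N) = ⊤ := by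
  have h := MonoidHom.map_closure (QuotientGroup.mk' N) S
  rw [hS, Subgroup.map_top_of_surjective _ (QuotientGroup.mk'_surjective N)] at h
  exact h.symm

/-- The choices that enter the metric of the box space of `Γ` along `K`: a finite generating set
of `Γ`, and for each `i` the distance `gap i` between the identity elements of the successive
quotients `Γ ⧸ K i` and `Γ ⧸ K (i + 1)`, which is greater than the diameters of both. -/
structure BoxChoice (K : ℕ → Subgroup Γ) [∀ i, (K i).Normal] where
  gen : Finset Γ
  closure_gen : Subgroup.closure (gen : Set Γ) = ⊤
  gap : ℕ → ℝ
  dist_lt_gap : ∀ (i : ℕ) (x y : Γ ⧸ K i), (wordDist (quotGen (gen : Set Γ) (K i)) x y : ℝ) < gap i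
  dist_succ_lt_gap : ∀ (i : ℕ) (x y : Γ ⧸ K (i + 1)),
    (wordDist (quotGen (gen : Set Γ) (K (i + 1))) x y : ℝ) < gap i

variable {K : ℕ → Subgroup Γ} [∀ i, (K i).Normal]

/-- The box space of `Γ` along `K`: the disjoint union of the quotients `Γ ⧸ K i`. -/
def BoxSpace (_D : BoxChoice K) : Type _ := Σ i : ℕ, Γ ⧸ K i

namespace BoxChoice

variable (D : BoxChoice K)

/-- The word metric of `Γ ⧸ K i` with respect to the image of the generating set. -/
noncomputable def quotDist (i : ℕ) (x y : Γ ⧸ K i) : ℝ :=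
  wordDist (quotGen (D.gen : Set Γ) (K i)) x y

/-- The distance between the identity elements of `Γ ⧸ K i` and `Γ ⧸ K j`: the sum of `gap k`
over `i ≤ k < j` if `i ≤ j`, and symmetrically. -/
noncomputable def idDist (i j : ℕ) : ℝ := ∑ k ∈ Finset.Ico (min i j) (max i j), D.gap k

/-- The metric of the box space: the word metric on each quotient, and
`d(α, e_i) + d(e_i, e_j) + d(e_j, β)` for `α`, `β` in different quotients. -/
noncomputable def boxDist (x y : BoxSpace D) : ℝ :=
  if h : x.1 = y.1 then D.quotDist y.1 (h ▸ x.2) y.2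
  else D.quotDist x.1 x.2 1 + D.idDist x.1 y.1 + D.quotDist y.1 1 y.2

theorem boxDist_same (i : ℕ) (x y : Γ ⧸ K i) :
    D.boxDist ⟨i, x⟩ ⟨i, y⟩ = D.quotDist i x y := by
  simp [boxDist]

theorem boxDist_of_ne {i j : ℕ} (h : i ≠ j) (x : Γ ⧸ K i) (y : Γ ⧸ K j) :
    D.boxDist ⟨i, x⟩ ⟨j, y⟩ = D.quotDist i x 1 + D.idDist i j + D.quotDist j 1 y := by
  simp [boxDist, h]

theorem quotDist_nonneg (i : ℕ) (x y : Γ ⧸ K i) : 0 ≤ D.quotDist i x y := Nat.cast_nonneg _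

theorem quotDist_self (i : ℕ) (x : Γ ⧸ K i) : D.quotDist i x x = 0 := by
  simp [quotDist, wordDist_self]

theorem quotDist_comm (i : ℕ) (x y : Γ ⧸ K i) : D.quotDist i x y = D.quotDist i y x := by
  rw [quotDist, quotDist, wordDist_comm (closure_quotGen D.closure_gen (K i))]

theorem quotDist_triangle (i : ℕ) (x y z : Γ ⧸ K i) :
    D.quotDist i x z ≤ D.quotDist i x y + D.quotDist i y z := by
  unfold quotDist
  exact_mod_cast wordDist_triangle (closure_quotGen D.closure_gen (K i)) x y z

theorem eq_of_quotDist {i : ℕ} {x y : Γ ⧸ K i} (h : D.quotDist i x y = 0) : x = y :=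
  eq_of_wordDist (closure_quotGen D.closure_gen (K i)) (Nat.cast_eq_zero.1 h)

theorem gap_pos (i : ℕ) : 0 < D.gap i :=
  lt_of_le_of_lt (Nat.cast_nonneg _) (D.dist_lt_gap i 1 1)

theorem idDist_comm (i j : ℕ) : D.idDist i j = D.idDist j i := by
  rw [idDist, idDist, min_comm, max_comm]

theorem idDist_eq (i j : ℕ) :
    D.idDist i j = |∑ k ∈ Finset.range j, D.gap k - ∑ k ∈ Finset.range i, D.gap k| := by
  have key : ∀ a b : ℕ, a ≤ b → D.idDist a b =
      |∑ k ∈ Finset.range b, D.gap k - ∑ k ∈ Finset.range a, D.gap k| := by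
    intro a b h
    rw [idDist, min_eq_left h, max_eq_right h, ← Finset.sum_Ico_eq_sub _ h, abs_of_nonneg]
    exact Finset.sum_nonneg fun k _ => (D.gap_pos k).le
  rcases le_total i j with h | h
  · exact key i j h
  · rw [idDist_comm, key j i h, abs_sub_comm]

theorem idDist_nonneg (i j : ℕ) : 0 ≤ D.idDist i j := by
  rw [idDist_eq]; exact abs_nonneg _

theorem idDist_triangle (i j k : ℕ) : D.idDist i k ≤ D.idDist i j + D.idDist j k := by
  rw [idDist_eq, idDist_eq, idDist_eq, add_comm]
  exact abs_sub_le _ _ _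

theorem quotDist_lt_idDist {i j : ℕ} (h : i ≠ j) (x y : Γ ⧸ K i) :
    D.quotDist i x y < D.idDist i j := by
  have hs : ∀ k ∈ Finset.Ico (min i j) (max i j), D.gap k ≤ D.idDist i j := fun k hk =>
    Finset.single_le_sum (f := D.gap) (fun k _ => (D.gap_pos k).le) hk
  rcases lt_or_gt_of_ne h with h | h
  · exact (D.dist_lt_gap i x y).trans_le (hs i (by simp; omega))
  · obtain ⟨k, rfl⟩ : ∃ k, i = k + 1 := ⟨i - 1, by omega⟩
    exact (D.dist_succ_lt_gap k x y).trans_le (hs k (by simp; omega))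

theorem boxDist_self (x : BoxSpace D) : D.boxDist x x = 0 := by
  obtain ⟨i, x⟩ := x
  rw [boxDist_same, quotDist_self]

theorem boxDist_comm (x y : BoxSpace D) : D.boxDist x y = D.boxDist y x := by
  obtain ⟨i, x⟩ := x
  obtain ⟨j, y⟩ := y
  by_cases h : i = j
  · subst h
    rw [boxDist_same, boxDist_same, quotDist_comm]
  · rw [boxDist_of_ne D h, boxDist_of_ne D (Ne.symm h), D.idDist_comm i j,
      D.quotDist_comm i x 1, D.quotDist_comm j 1 y]
    ring

theorem boxDist_triangle (x y z : BoxSpace D) :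
    D.boxDist x z ≤ D.boxDist x y + D.boxDist y z := by
  obtain ⟨i, x⟩ := x
  obtain ⟨j, y⟩ := y
  obtain ⟨k, z⟩ := z
  by_cases hij : i = j
  · subst hij
    by_cases hik : i = k
    · subst hik
      simpa only [boxDist_same] using D.quotDist_triangle i x y z
    · rw [boxDist_of_ne D hik, boxDist_of_ne D hik, boxDist_same]
      linarith [D.quotDist_triangle i x y 1]
  · by_cases hik : i = k
    · subst hik
      rw [boxDist_of_ne D hij, boxDist_of_ne D (Ne.symm hij), boxDist_same]
      linarith [D.quotDist_lt_idDist hij x z, D.quotDist_nonneg i x 1, D.quotDist_nonneg j 1 y,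
        D.quotDist_nonneg j y 1, D.idDist_nonneg j i, D.quotDist_nonneg i 1 z]
    · by_cases hjk : j = k
      · subst hjk
        rw [boxDist_of_ne D hij, boxDist_of_ne D hij, boxDist_same]
        linarith [D.quotDist_triangle j 1 y z]
      · rw [boxDist_of_ne D hik, boxDist_of_ne D hij, boxDist_of_ne D hjk]
        linarith [D.idDist_triangle i j k, D.quotDist_nonneg j 1 y, D.quotDist_nonneg j y 1]

theorem eq_of_boxDist (x y : BoxSpace D) (h : D.boxDist x y = 0) : x = y := by
  obtain ⟨i, x⟩ := x
  obtain ⟨j, y⟩ := y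
  by_cases hij : i = j
  · subst hij
    rw [boxDist_same] at h
    rw [D.eq_of_quotDist h]
  · rw [boxDist_of_ne D hij] at h
    exfalso
    have := D.quotDist_lt_idDist hij 1 1
    linarith [D.quotDist_nonneg i 1 1, D.quotDist_nonneg i x 1, D.quotDist_nonneg j 1 y]

end BoxChoice

noncomputable instance (D : BoxChoice K) : MetricSpace (BoxSpace D) where
  dist := D.boxDist
  dist_self := D.boxDist_self
  dist_comm := D.boxDist_comm
  dist_triangle := D.boxDist_triangle
  eq_of_dist_eq_zero := fun {x y} h => D.eq_of_boxDist x y h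

end Box

section Extension

variable {H Γ G : Type*} [Group H] [Group Γ] [Group G]

/-- For an extension `1 → H → Γ → G → 1`, the box space of `H` along the subgroups `H ∩ K i`:
the disjoint union of the quotients `H ⧸ (H ∩ K i)`. -/
def InducedBoxSpace (E : GroupExtension H Γ G) {K : ℕ → Subgroup Γ} [∀ i, (K i).Normal]
    (_D : BoxChoice K) : Type _ := Σ i : ℕ, H ⧸ (K i).comap E.inl

/-- The inclusion `h (H ∩ K i) ↦ h K i` into the box space of `Γ`. -/
def InducedBoxSpace.incl (E : GroupExtension H Γ G) {K : ℕ → Subgroup Γ} [∀ i, (K i).Normal]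
    (D : BoxChoice K) (x : InducedBoxSpace E D) : BoxSpace D :=
  ⟨x.1, QuotientGroup.map ((K x.1).comap E.inl) (K x.1) E.inl le_rfl x.2⟩

theorem InducedBoxSpace.incl_injective (E : GroupExtension H Γ G) {K : ℕ → Subgroup Γ}
    [∀ i, (K i).Normal] (D : BoxChoice K) :
    Function.Injective (InducedBoxSpace.incl E D) := by
  rintro ⟨i, x⟩ ⟨j, y⟩ h
  obtain rfl : i = j := congrArg Sigma.fst h
  have h2 : QuotientGroup.map ((K i).comap E.inl) (K i) E.inl le_rfl x =
      QuotientGroup.map ((K i).comap E.inl) (K i) E.inl le_rfl y :=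
    eq_of_heq (Sigma.mk.inj h).2
  induction x using QuotientGroup.induction_on with | H a => ?_
  induction y using QuotientGroup.induction_on with | H b => ?_
  rw [QuotientGroup.map_mk, QuotientGroup.map_mk, QuotientGroup.eq, ← map_inv, ← map_mul] at h2
  have h3 : (a : H ⧸ (K i).comap E.inl) = b := QuotientGroup.eq.2 (Subgroup.mem_comap.2 h2)
  rw [h3]

/-- The metric induced on the box space of `H` by the metric of the box space of `Γ`. -/
noncomputable instance (E : GroupExtension H Γ G) {K : ℕ → Subgroup Γ} [∀ i, (K i).Normal]
    (D : BoxChoice K) : MetricSpace (InducedBoxSpace E D) :=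
  MetricSpace.induced (InducedBoxSpace.incl E D) (InducedBoxSpace.incl_injective E D) inferInstance

/-- The subgroup `H N / H` of `G`, for a subgroup `N` of `Γ`. -/
def quotSubgroup (E : GroupExtension H Γ G) (N : Subgroup Γ) : Subgroup G :=
  (E.inl.range ⊔ N).map E.rightHom

/-- The subgroup `L` of `G`: the intersection of the subgroups `H K i / H`. -/
def limitSubgroup (E : GroupExtension H Γ G) (K : ℕ → Subgroup Γ) : Subgroup G :=
  ⨅ i, quotSubgroup E (K i)

instance (E : GroupExtension H Γ G) (N : Subgroup Γ) [N.Normal] : (quotSubgroup E N).Normal := by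
  have h : E.inl.range.Normal := by
    rw [E.range_inl_eq_ker_rightHom]
    infer_instance
  exact Subgroup.Normal.map inferInstance _ E.rightHom_surjective

instance (E : GroupExtension H Γ G) (K : ℕ → Subgroup Γ) [∀ i, (K i).Normal] :
    (limitSubgroup E K).Normal :=
  Subgroup.normal_iInf_normal fun _ => inferInstance

end Extension

open scoped Pointwise in
open Classical in
/-- Amenability of a discrete group, in Følner's form: for every finite set `T` and every `ε > 0`
there is a non-empty finite set `A` with `|g A ∆ A| ≤ ε |A|` for all `g ∈ T`. -/
def IsAmenable (Q : Type*) [Group Q] : Prop :=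
  ∀ (T : Finset Q) (ε : ℝ), 0 < ε → ∃ A : Finset Q, A.Nonempty ∧
    ∀ g ∈ T, ((symmDiff (g • A) A).card : ℝ) ≤ ε * A.card

/-- `X` is coarsely embeddable in `Y`. -/
def CoarselyEmbeddable (X Y : Type*) [MetricSpace X] [MetricSpace Y] : Prop :=
  ∃ (F : X → Y) (ρ₁ ρ₂ : ℝ≥0 → ℝ≥0), Monotone ρ₁ ∧ Monotone ρ₂ ∧
    Filter.Tendsto ρ₁ Filter.atTop Filter.atTop ∧ Filter.Tendsto ρ₂ Filter.atTop Filter.atTop ∧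
    ∀ x x' : X, ρ₁ (nndist x x') ≤ nndist (F x) (F x') ∧
      nndist (F x) (F x') ≤ ρ₂ (nndist x x')

/-- `X` coarsely embeds into the Hilbert space `ℓ²(ℕ)`. For countable spaces such as box spaces
this is the same as a coarse embedding into some Hilbert space, because the image spans a
separable subspace. -/
def CoarselyEmbedsIntoHilbert (X : Type*) [MetricSpace X] : Prop :=
  CoarselyEmbeddable X (lp (fun _ : ℕ => ℝ) 2)

end BoxSpaces

/-! It suffices to embed all `Γ ⧸ K i` into `ℓ²` with bounds uniform in `i`: the components are then
spread out along a reserved coordinate (`coarselyEmbedsIntoHilbert_of_uniform`). Uniform embeddings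
come from normalized positive kernels `Φ` that are nearly `1` at distance at most `R` and at most
`1/2` far away (`exists_uniform_embedding`): sums of `1 - Φ` are conditionally negative, hence
squared Hilbert distances.

The kernels (`exists_kernels`) combine the two hypotheses. Left invariance carries the embedding of
the box space of `H` to a map `u` on all cosets of the image of `H` in `Γ ⧸ K i`; a Gaussian of `u`,
cut off outside these cosets, is a positive kernel `κ`. With lifts `σ a` of the elements of a Følner
set `A` of `G ⧸ L`, the kernel is the sum of `κ (x σ a) (y σ b)` over `a, b ∈ A`, divided by `|A|`.
The Følner condition gives small variation, and the Gaussian gives decay. For large `i` distinct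
elements of `A` lie in distinct cosets of `H K i`, which gives the value `1` on the diagonal; the
finitely many other quotients are bounded and receive the constant kernel. -/

namespace BoxSpaces

/-! ### Positive and conditionally negative kernels on finite sets. -/

section Kernels

variable {X Y : Type*} [Fintype X] [Fintype Y]

/-- A symmetric kernel on a finite set whose quadratic form is non-negative. -/
structure IsPosKernel (k : X → X → ℝ) : Prop where
  symm : ∀ x y, k x y = k y x
  nonneg : ∀ c : X → ℝ, 0 ≤ ∑ x, ∑ y, c x * c y * k x y

theorem isPosKernel_iff_posSemidef {k : X → X → ℝ} :
    IsPosKernel k ↔ (Matrix.of k).PosSemidef := by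
  have h : ∀ c : X → ℝ, star c ⬝ᵥ (Matrix.of k).mulVec c = ∑ x, ∑ y, c x * c y * k x y := by
    intro c
    simp only [dotProduct, Matrix.mulVec, Matrix.of_apply, Finset.mul_sum, star_trivial]
    exact Finset.sum_congr rfl fun x _ => Finset.sum_congr rfl fun y _ => by ring
  rw [Matrix.posSemidef_iff_dotProduct_mulVec]
  constructor
  · intro hk
    exact ⟨Matrix.IsHermitian.ext fun x y => by simpa using hk.symm y x, fun c => by
      rw [h]; exact hk.nonneg c⟩
  · rintro ⟨h1, h2⟩
    exact ⟨fun x y => by simpa using (h1.apply x y).symm, fun c => by rw [← h]; exact h2 c⟩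

theorem IsPosKernel.mul {k l : X → X → ℝ} (hk : IsPosKernel k) (hl : IsPosKernel l) :
    IsPosKernel fun x y => k x y * l x y :=
  isPosKernel_iff_posSemidef.2
    ((isPosKernel_iff_posSemidef.1 hk).hadamard (isPosKernel_iff_posSemidef.1 hl))

theorem IsPosKernel.comp {k : X → X → ℝ} (hk : IsPosKernel k) (f : Y → X) :
    IsPosKernel fun x y => k (f x) (f y) :=
  isPosKernel_iff_posSemidef.2 ((isPosKernel_iff_posSemidef.1 hk).submatrix f)

theorem isPosKernel_one : IsPosKernel fun _ _ : X => (1 : ℝ) where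
  symm _ _ := rfl
  nonneg c := by
    simp only [mul_one, ← Finset.mul_sum, ← Finset.sum_mul]
    exact mul_self_nonneg _

theorem IsPosKernel.pow {k : X → X → ℝ} (hk : IsPosKernel k) (n : ℕ) :
    IsPosKernel fun x y => k x y ^ n := by
  induction n with
  | zero => simpa using isPosKernel_one
  | succ n ih => simpa only [pow_succ] using ih.mul hk

theorem IsPosKernel.const_mul {k : X → X → ℝ} (hk : IsPosKernel k) {a : ℝ} (ha : 0 ≤ a) :
    IsPosKernel fun x y => a * k x y where
  symm x y := by rw [hk.symm]
  nonneg c := by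
    have := mul_nonneg ha (hk.nonneg c)
    simp only [Finset.mul_sum] at this
    simpa only [mul_left_comm a] using this

theorem IsPosKernel.hasSum {k : ℕ → X → X → ℝ} (hk : ∀ n, IsPosKernel (k n)) {l : X → X → ℝ}
    (h : ∀ x y, HasSum (fun n => k n x y) (l x y)) : IsPosKernel l where
  symm x y := (h x y).unique (by simpa only [(hk _).symm x y] using h y x)
  nonneg c := by
    have : HasSum (fun n => ∑ x, ∑ y, c x * c y * k n x y) (∑ x, ∑ y, c x * c y * l x y) :=
      hasSum_sum fun x _ => hasSum_sum fun y _ => (h x y).mul_left _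
    exact this.nonneg fun n => (hk n).nonneg c

theorem IsPosKernel.exp {k : X → X → ℝ} (hk : IsPosKernel k) :
    IsPosKernel fun x y => Real.exp (k x y) := by
  refine IsPosKernel.hasSum (k := fun n x y => (n.factorial : ℝ)⁻¹ * k x y ^ n)
    (fun n => (hk.pow n).const_mul (by positivity)) fun x y => ?_
  rw [Real.exp_eq_exp_ℝ]
  exact NormedSpace.exp_series_hasSum_exp' (𝕂 := ℝ) (k x y)

theorem IsPosKernel.mul_mul {k : X → X → ℝ} (hk : IsPosKernel k) (g : X → ℝ) :
    IsPosKernel fun x y => g x * g y * k x y where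
  symm x y := by rw [hk.symm, mul_comm (g x)]
  nonneg c := by
    refine (hk.nonneg fun x => c x * g x).trans_eq ?_
    exact Finset.sum_congr rfl fun x _ => Finset.sum_congr rfl fun y _ => by ring

/-- The Gaussian kernel is positive. -/
theorem isPosKernel_gaussian {V : Type*} [NormedAddCommGroup V] [InnerProductSpace ℝ V]
    (u : X → V) {t : ℝ} (ht : 0 ≤ t) :
    IsPosKernel fun x y => Real.exp (-(t * ‖u x - u y‖ ^ 2)) := by
  have hg : IsPosKernel fun x y => inner ℝ (u x) (u y) :=
    isPosKernel_iff_posSemidef.2 (Matrix.posSemidef_gram ℝ u)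
  -- Expanding `‖u x - u y‖ ^ 2` splits the Gaussian into `exp (2 t ⟪u x, u y⟫)` and one factor for
  -- each variable.
  have := ((hg.const_mul (a := 2 * t) (by positivity)).exp).mul_mul
    fun x => Real.exp (-(t * ‖u x‖ ^ 2))
  convert this using 3 with x y
  rw [← Real.exp_add, ← Real.exp_add, @norm_sub_sq ℝ]
  congr 1
  simp only [RCLike.re_to_real]
  ring

/-- The restriction of a positive kernel to the blocks of a partition is positive. -/
theorem IsPosKernel.blocks {k : X → X → ℝ} (hk : IsPosKernel k) {Q : Type*} [Fintype Q]
    [DecidableEq Q] (p : X → Q) :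
    IsPosKernel fun x y => if p x = p y then k x y else 0 where
  symm x y := by simp only [hk.symm x y, eq_comm]
  nonneg c := by
    -- The form splits into the forms of `k` at the restrictions of `c` to the blocks.
    have h : ∑ x, ∑ y, c x * c y * (if p x = p y then k x y else 0) =
        ∑ q, ∑ x, ∑ y, (if p x = q then c x else 0) * (if p y = q then c y else 0) * k x y := by
      symm
      rw [Finset.sum_comm]
      refine Finset.sum_congr rfl fun x _ => ?_
      rw [Finset.sum_comm]
      refine Finset.sum_congr rfl fun y _ => ?_
      rw [Finset.sum_eq_single (p x)]
      · by_cases h : p x = p y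
        · simp [h]
        · simp [h, Ne.symm h]
      · intro q _ hq
        simp [Ne.symm hq]
      · simp
    rw [h]
    exact Finset.sum_nonneg fun q _ => hk.nonneg _

/-- Averaging a positive kernel over finitely many maps gives a positive kernel. -/
theorem IsPosKernel.sum_sum {k : X → X → ℝ} (hk : IsPosKernel k) {ι : Type*} [Fintype ι]
    (f : ι → Y → X) : IsPosKernel fun x y => ∑ b, ∑ b', k (f b x) (f b' y) where
  symm x y := by
    rw [Finset.sum_comm]
    simp only [hk.symm]
  nonneg c := by
    -- Pull `k` back to `ι × Y` and test it on a function independent of the index in `ι`.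
    have := (hk.comp fun z : ι × Y => f z.1 z.2).nonneg fun z => c z.2
    simp only [Fintype.sum_prod_type] at this
    refine this.trans_eq ?_
    simp only [Finset.mul_sum]
    rw [Finset.sum_comm]
    refine Finset.sum_congr rfl fun x _ => ?_
    rw [Finset.sum_comm (s := (Finset.univ : Finset Y))]
    exact Finset.sum_congr rfl fun b _ => Finset.sum_comm

/-- Test the form on the difference of the point masses at `x` and `y`. For normalized kernels this
gives the bound `k ≤ 1`. -/
theorem IsPosKernel.apply_le {k : X → X → ℝ} (hk : IsPosKernel k) (x y : X) :
    2 * k x y ≤ k x x + k y y := by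
  classical
  have := hk.nonneg fun z => (if z = x then 1 else 0) - (if z = y then 1 else 0)
  simp [sub_mul, mul_sub, Finset.sum_sub_distrib] at this
  linarith [hk.symm x y]

/-- An orthonormal family in `ℓ²` with vanishing coordinate at `0`. -/
theorem exists_orthonormal_lp (X : Type*) [Finite X] :
    ∃ e : X → lp (fun _ : ℕ => ℝ) 2, Orthonormal ℝ e ∧ ∀ x, e x 0 = 0 := by
  obtain ⟨n, ⟨f⟩⟩ := Finite.exists_equiv_fin X
  let b : HilbertBasis ℕ ℝ (lp (fun _ : ℕ => ℝ) 2) := default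
  refine ⟨fun x => b ((f x : ℕ) + 1), b.orthonormal.comp (fun x => (f x : ℕ) + 1) ?_, fun x => ?_⟩
  · intro x y h
    exact f.injective (Fin.ext (Nat.succ_injective h))
  · have : b ((f x : ℕ) + 1) = lp.single 2 ((f x : ℕ) + 1) (1 : ℝ) := by
      exact b.repr_self _
    simp [this]

/-- Factor the matrix as `Bᵀ B` and use the columns of `B` as coordinates in an orthonormal family.
Coordinate `0` stays free for separating the components of the box space. -/
theorem IsPosKernel.exists_lp {k : X → X → ℝ} (hk : IsPosKernel k) :
    ∃ F : X → lp (fun _ : ℕ => ℝ) 2, (∀ x, F x 0 = 0) ∧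
      ∀ x y, ‖F x - F y‖ ^ 2 = k x x + k y y - 2 * k x y := by
  classical
  obtain ⟨e, he, he0⟩ := exists_orthonormal_lp X
  obtain ⟨B, hB⟩ : ∃ B : Matrix X X ℝ, Matrix.of k = B.conjTranspose * B := by
    open scoped MatrixOrder in
    exact CStarAlgebra.nonneg_iff_eq_star_mul_self.1 (isPosKernel_iff_posSemidef.1 hk).nonneg
  have hk' : ∀ x y, k x y = ∑ z, B z x * B z y := by
    intro x y
    have := congrFun (congrFun hB x) y
    simpa [Matrix.mul_apply] using this
  refine ⟨fun x => ∑ z, B z x • e z, fun x => ?_, fun x y => ?_⟩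
  · rw [lp.coeFn_sum, Finset.sum_apply]
    simp [he0]
  · simp only [← Finset.sum_sub_distrib, ← sub_smul]
    rw [← real_inner_self_eq_norm_sq, he.inner_sum]
    simp only [hk', Finset.mul_sum, ← Finset.sum_add_distrib, ← Finset.sum_sub_distrib]
    refine Finset.sum_congr rfl fun z _ => ?_
    simp
    ring

/-- A conditionally negative kernel on a finite set is a squared distance. -/
theorem exists_lp_of_condNeg {k : X → X → ℝ} (hs : ∀ x y, k x y = k y x) (h0 : ∀ x, k x x = 0)
    (hk : ∀ c : X → ℝ, ∑ x, c x = 0 → ∑ x, ∑ y, c x * c y * k x y ≤ 0) (e : X) :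
    ∃ F : X → lp (fun _ : ℕ => ℝ) 2, (∀ x, F x 0 = 0) ∧ F e = 0 ∧
      ∀ x y, ‖F x - F y‖ ^ 2 = 2 * k x y := by
  classical
  have hP : IsPosKernel fun x y => k x e + k y e - k x y := by
    refine ⟨fun x y => by rw [hs x y]; ring, fun c => ?_⟩
    -- Subtracting the total mass of `c` at `e` produces a test function of sum zero.
    have h := hk (fun x => c x - if x = e then ∑ y, c y else 0) (by simp)
    simp only [sub_mul, mul_sub, Finset.sum_sub_distrib, mul_add, Finset.sum_add_distrib] at h ⊢
    simp [h0, hs e] at h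
    have h1 : ∑ x, ∑ y, c x * c y * k x e = (∑ y, c y) * ∑ x, c x * k x e := by
      rw [Finset.mul_sum]
      refine Finset.sum_congr rfl fun x _ => ?_
      rw [Finset.sum_mul]
      exact Finset.sum_congr rfl fun y _ => by ring
    have h2 : ∑ x, ∑ y, c x * c y * k y e = (∑ y, c y) * ∑ x, c x * k x e := by
      rw [Finset.sum_mul]
      refine Finset.sum_congr rfl fun x _ => ?_
      rw [Finset.mul_sum]
      exact Finset.sum_congr rfl fun y _ => by ring
    have h3 : ∑ x, (c x * ∑ y, c y) * k x e = (∑ y, c y) * ∑ x, c x * k x e := by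
      rw [Finset.mul_sum]
      exact Finset.sum_congr rfl fun x _ => by ring
    have h4 : ∑ x, (∑ y, c y) * c x * k x e = (∑ y, c y) * ∑ x, c x * k x e := by
      rw [Finset.mul_sum]
      exact Finset.sum_congr rfl fun x _ => by ring
    linarith
  obtain ⟨F, hF0, hF⟩ := hP.exists_lp
  refine ⟨fun x => F x - F e, fun x => by simp [hF0], sub_self _, fun x y => ?_⟩
  rw [sub_sub_sub_cancel_right, hF, h0, h0]
  ring

end Kernels

/-! ### From kernels to uniform embeddings of a family. -/

section Family

/-- A family of finite sets with distance functions embeds uniformly into `ℓ²` as soon as there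
are normalized positive kernels of arbitrarily small variation which are small at large
distances, uniformly over the family. -/
theorem exists_uniform_embedding {X : ℕ → Type*} [∀ i, Fintype (X i)] (e : ∀ i, X i)
    (d : ∀ i, X i → X i → ℕ)
    (h : ∀ (R : ℕ) (ε : ℝ), 0 < ε → ∃ Φ : ∀ i, X i → X i → ℝ, (∀ i, IsPosKernel (Φ i)) ∧
      (∀ i x, Φ i x x = 1) ∧ (∀ i x y, 0 ≤ Φ i x y) ∧
      (∀ i x y, d i x y ≤ R → 1 - ε ≤ Φ i x y) ∧
      ∃ S : ℕ, ∀ i x y, S ≤ d i x y → Φ i x y ≤ 1 / 2) :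
    ∃ F : ∀ i, X i → lp (fun _ : ℕ => ℝ) 2, (∀ i x, F i x 0 = 0) ∧ (∀ i, F i (e i) = 0) ∧
      (∀ i x y, ‖F i x - F i y‖ ^ 2 ≤ 2 * (d i x y + 2)) ∧
      ∀ N : ℕ, ∃ S : ℕ, ∀ i x y, S ≤ d i x y → N ≤ ‖F i x - F i y‖ ^ 2 := by
  choose Φ hpos hone hnn hvar S hS using fun n : ℕ => h n ((1 / 2) ^ n) (by positivity)
  have hle : ∀ n i x y, Φ n i x y ≤ 1 := by
    intro n i x y
    have := (hpos n i).apply_le x y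
    rw [hone, hone] at this
    linarith
  have hfin : ∀ m : ℕ, HasSum (fun n => if n < m then (1 : ℝ) else 0) m := by
    intro m
    have : HasSum (fun n => if n < m then (1 : ℝ) else 0)
        (∑ n ∈ Finset.range m, if n < m then (1 : ℝ) else 0) :=
      hasSum_sum_of_ne_finset_zero (by simp +contextual)
    rwa [Finset.sum_congr rfl fun n hn => if_pos (Finset.mem_range.1 hn), Finset.sum_const,
      Finset.card_range, nsmul_one] at this
  -- The `n`-th kernel has parameters `R = n` and `ε = 2⁻ⁿ`: only the terms with `n < d` can be
  -- large, and the tails sum to `2`.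
  have hbd : ∀ i x y n, 1 - Φ n i x y ≤ (if n < d i x y then 1 else 0) + (1 / 2) ^ n := by
    intro i x y n
    split_ifs with hn
    · have : (0 : ℝ) ≤ (1 / 2) ^ n := by positivity
      linarith [hnn n i x y]
    · linarith [hvar n i x y (not_lt.1 hn)]
  have hbs : ∀ i x y, HasSum (fun n => (if n < d i x y then (1 : ℝ) else 0) + (1 / 2) ^ n)
      (d i x y + 2) := fun i x y => (hfin _).add hasSum_geometric_two
  have hsum : ∀ i x y, Summable fun n => 1 - Φ n i x y := fun i x y =>
    Summable.of_nonneg_of_le (fun n => sub_nonneg.2 (hle n i x y)) (hbd i x y)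
      (hbs i x y).summable
  set Ψ : ∀ i, X i → X i → ℝ := fun i x y => ∑' n, (1 - Φ n i x y) with hΨ
  have hΨs : ∀ i x y, HasSum (fun n => 1 - Φ n i x y) (Ψ i x y) := fun i x y =>
    (hsum i x y).hasSum
  have hF : ∀ i, ∃ F : X i → lp (fun _ : ℕ => ℝ) 2, (∀ x, F x 0 = 0) ∧ F (e i) = 0 ∧
      ∀ x y, ‖F x - F y‖ ^ 2 = 2 * Ψ i x y := by
    intro i
    refine exists_lp_of_condNeg (fun x y => ?_) (fun x => ?_) (fun c hc => ?_) (e i)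
    · simp only [hΨ, (hpos _ i).symm x y]
    · simp [hΨ, hone]
    · have hs : HasSum (fun n => ∑ x, ∑ y, c x * c y * (1 - Φ n i x y))
          (∑ x, ∑ y, c x * c y * Ψ i x y) :=
        hasSum_sum fun x _ => hasSum_sum fun y _ => (hΨs i x y).mul_left _
      refine hs.nonpos fun n => ?_
      -- The constant `1` contributes nothing since `c` has sum zero.
      simp only [mul_sub, mul_one, Finset.sum_sub_distrib, ← Finset.mul_sum, hc, mul_zero,
        zero_sub, Finset.sum_neg_distrib]
      exact neg_nonpos.2 ((hpos n i).nonneg c)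
  choose F hF0 hFe hFn using hF
  refine ⟨F, hF0, hFe, fun i x y => ?_, fun N => ⟨(Finset.range N).sup S, fun i x y hd => ?_⟩⟩
  · rw [hFn]
    have := hasSum_le (hbd i x y) (hΨs i x y) (hbs i x y)
    linarith
  · rw [hFn]
    have h1 : ∑ n ∈ Finset.range N, (1 - Φ n i x y) ≤ Ψ i x y :=
      sum_le_hasSum _ (fun n _ => sub_nonneg.2 (hle n i x y)) (hΨs i x y)
    -- Beyond all of the first `N` thresholds, each of these terms is at least `1/2`; the factor `2`
    -- in `hFn` turns `N / 2` into `N`.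
    have h2 : ∑ _n ∈ Finset.range N, (1 / 2 : ℝ) ≤ ∑ n ∈ Finset.range N, (1 - Φ n i x y) := by
      refine Finset.sum_le_sum fun n hn => ?_
      linarith [hS n i x y ((Finset.le_sup hn).trans hd)]
    rw [Finset.sum_const, Finset.card_range, nsmul_eq_mul] at h2
    linarith

end Family

/-! ### Gluing uniform embeddings of the components. -/

section Criterion

/-- A map that is bounded above by an affine function of the distance and tends to infinity with
the distance is a coarse embedding. -/
theorem coarselyEmbeddable_of_bounds {X Y : Type*} [MetricSpace X] [MetricSpace Y] [Nonempty X]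
    (F : X → Y) (a b : ℝ≥0) (ha : 0 < a) (hup : ∀ x x', dist (F x) (F x') ≤ a * dist x x' + b)
    (hlow : ∀ N : ℕ, ∃ S : ℝ≥0, ∀ x x', S ≤ dist x x' → N ≤ dist (F x) (F x')) :
    CoarselyEmbeddable X Y := by
  -- The lower control is the infimum over all pairs of the image distance plus the truncated
  -- difference `r - d`. For `r ≥ S + N`, pairs at distance at least `S` have a first term at least
  -- `N`, and the other pairs a second one.
  refine ⟨F, fun r => ⨅ p : X × X, nndist (F p.1) (F p.2) + (r - nndist p.1 p.2),
    fun r => a * r + b, fun r s hrs => ?_, fun r s hrs => ?_, ?_, ?_, fun x x' => ⟨?_, ?_⟩⟩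
  · exact ciInf_mono (OrderBot.bddBelow _) fun p =>
      add_le_add_right (tsub_le_tsub_right hrs _) _
  · dsimp only
    gcongr
  · refine Filter.tendsto_atTop.2 fun c => ?_
    obtain ⟨N, hN⟩ := exists_nat_ge c
    obtain ⟨S, hS⟩ := hlow N
    filter_upwards [Filter.eventually_ge_atTop (S + N)] with r hr
    refine le_ciInf fun p => hN.trans ?_
    rcases le_total S (nndist p.1 p.2) with h | h
    · exact le_add_right (by exact_mod_cast hS p.1 p.2 (by exact_mod_cast h))
    · refine le_add_left (le_tsub_of_add_le_left (le_trans ?_ hr))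
      gcongr
  · exact Filter.tendsto_atTop_mono (fun r => le_self_add) (Filter.tendsto_id.const_mul_atTop ha)
  · refine (ciInf_le (OrderBot.bddBelow _) (x, x')).trans ?_
    simp
  · exact_mod_cast hup x x'

namespace BoxChoice

variable {Γ : Type*} [Group Γ] {K : ℕ → Subgroup Γ} [∀ i, (K i).Normal] (D : BoxChoice K)

/-- A box space embeds coarsely into Hilbert space if its components do so uniformly. -/
theorem coarselyEmbedsIntoHilbert_of_uniform (F : ∀ i, Γ ⧸ K i → lp (fun _ : ℕ => ℝ) 2)
    (h0 : ∀ i x, F i x 0 = 0) (hone : ∀ i, F i 1 = 0)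
    (hup : ∀ i x y, ‖F i x - F i y‖ ^ 2 ≤ 2 * (D.quotDist i x y + 2))
    (hlow : ∀ N : ℕ, ∃ S : ℕ, ∀ i x y, S ≤ D.quotDist i x y → N ≤ ‖F i x - F i y‖ ^ 2) :
    CoarselyEmbedsIntoHilbert (BoxSpace D) := by
  let p : ℕ → ℝ := fun i => ∑ k ∈ Finset.range i, D.gap k
  let e : lp (fun _ : ℕ => ℝ) 2 := lp.single 2 0 (1 : ℝ)
  have he : ‖e‖ = 1 := by simp [e]
  have he0 : e 0 = 1 := by simp [e]
  -- `2 (d + 2) ≤ (d + 2) ^ 2`, as `d ≥ 0`.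
  have hup' : ∀ i x y, ‖F i x - F i y‖ ≤ D.quotDist i x y + 2 := by
    intro i x y
    have h := D.quotDist_nonneg i x y
    refine abs_le_of_sq_le_sq' ?_ (by linarith) |>.2
    nlinarith [hup i x y]
  have : Nonempty (BoxSpace D) := ⟨⟨0, 1⟩⟩
  -- The component `i` is shifted to height `p i` in coordinate `0`. The constant `4` is `2` for
  -- each of the two paths through identity elements.
  refine coarselyEmbeddable_of_bounds (fun z => F z.1 z.2 + p z.1 • e) 1 4 one_pos ?_ ?_
  · rintro ⟨i, x⟩ ⟨j, y⟩
    change dist (F i x + p i • e) (F j y + p j • e) ≤ 1 * D.boxDist ⟨i, x⟩ ⟨j, y⟩ + (4 : ℝ)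
    rw [dist_eq_norm, one_mul]
    by_cases hij : i = j
    · subst hij
      rw [D.boxDist_same, add_sub_add_right_eq_sub]
      linarith [hup' i x y]
    · rw [D.boxDist_of_ne hij, D.idDist_eq, abs_sub_comm]
      have h1 := hup' i x 1
      have h2 := hup' j 1 y
      rw [hone, sub_zero] at h1
      rw [hone, zero_sub, norm_neg] at h2
      have h3 : F i x + p i • e - (F j y + p j • e) = F i x - F j y + (p i - p j) • e := by
        rw [sub_smul]; abel
      rw [h3]
      have h4 := norm_add_le (F i x - F j y) ((p i - p j) • e)
      have h5 := norm_sub_le (F i x) (F j y)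
      rw [norm_smul, he, mul_one, Real.norm_eq_abs] at h4
      linarith
  · intro N
    obtain ⟨S, hS⟩ := hlow (N ^ 2)
    -- Across components the distance has three summands, none larger than `idDist i j`, which
    -- equals the difference of the heights.
    refine ⟨max S (3 * N), ?_⟩
    rintro ⟨i, x⟩ ⟨j, y⟩ hd
    change _ ≤ D.boxDist ⟨i, x⟩ ⟨j, y⟩ at hd
    change _ ≤ dist (F i x + p i • e) (F j y + p j • e)
    rw [dist_eq_norm]
    rw [NNReal.coe_max, max_le_iff] at hd
    push_cast at hd
    by_cases hij : i = j
    · subst hij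
      rw [D.boxDist_same] at hd
      rw [add_sub_add_right_eq_sub]
      have := hS i x y hd.1
      push_cast at this
      exact abs_le_of_sq_le_sq' this (norm_nonneg _) |>.2
    · rw [D.boxDist_of_ne hij] at hd
      have h1 := lp.norm_apply_le_norm (p := 2) (by norm_num)
        (F i x + p i • e - (F j y + p j • e)) 0
      have h2 : (F i x + p i • e - (F j y + p j • e)) 0 = p i - p j := by
        change F i x 0 + p i * e 0 - (F j y 0 + p j * e 0) = _
        simp [h0, he0]
      rw [h2, Real.norm_eq_abs] at h1
      have h3 := D.quotDist_lt_idDist hij x 1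
      have h4 := D.quotDist_lt_idDist (Ne.symm hij) 1 y
      rw [D.idDist_comm j i] at h4
      have h5 := D.idDist_eq i j
      rw [abs_sub_comm] at h5
      change D.idDist i j = |p i - p j| at h5
      linarith

end BoxChoice

end Criterion

/-! ### Word lengths under quotients and right translations. -/

section WordLength

variable {Γ : Type*} [Group Γ] {S : Set Γ}

theorem wordLength_mk_le (hS : Subgroup.closure S = ⊤) (N : Subgroup Γ) [N.Normal] (g : Γ) :
    wordLength (quotGen S N) (g : Γ ⧸ N) ≤ wordLength S g := by
  obtain ⟨w, hw, hwg, hwl⟩ := exists_word hS g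
  have h : IsWord (quotGen S N) (w.map (QuotientGroup.mk' N)) := by
    intro s hs
    obtain ⟨t, ht, rfl⟩ := List.mem_map.1 hs
    exact (hw t ht).imp (fun h => ⟨t, h, rfl⟩) fun h => ⟨t⁻¹, h, rfl⟩
  have := wordLength_le h
  rwa [← map_list_prod, hwg, List.length_map, hwl] at this

theorem exists_lift_wordLength_le (hS : Subgroup.closure S = ⊤) (N : Subgroup Γ) [N.Normal]
    (q : Γ ⧸ N) : ∃ g : Γ, (g : Γ ⧸ N) = q ∧ wordLength S g ≤ wordLength (quotGen S N) q := by
  obtain ⟨w, hw, hwq, hwl⟩ := exists_word (closure_quotGen hS N) q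
  have hlift : ∀ s : Γ ⧸ N, (s ∈ quotGen S N ∨ s⁻¹ ∈ quotGen S N) →
      ∃ t : Γ, (t ∈ S ∨ t⁻¹ ∈ S) ∧ (t : Γ ⧸ N) = s := by
    rintro s (⟨t, ht, h⟩ | ⟨t, ht, h⟩)
    · exact ⟨t, Or.inl ht, h⟩
    · exact ⟨t⁻¹, Or.inr (by rwa [inv_inv]), by
        rw [QuotientGroup.mk_inv, inv_eq_iff_eq_inv]; exact h⟩
  have key : ∀ w : List (Γ ⧸ N), IsWord (quotGen S N) w →
      ∃ v : List Γ, IsWord S v ∧ ((v.prod : Γ) : Γ ⧸ N) = w.prod ∧ v.length = w.length := by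
    intro w
    induction w with
    | nil => exact fun _ => ⟨[], by simp [IsWord], rfl, rfl⟩
    | cons s w ih =>
      intro h
      obtain ⟨v, hv, hvp, hvl⟩ := ih fun t ht => h t (List.mem_cons_of_mem _ ht)
      obtain ⟨t, ht, rfl⟩ := hlift s (h s List.mem_cons_self)
      refine ⟨t :: v, ?_, ?_, by simp [hvl]⟩
      · intro a ha
        rcases List.mem_cons.1 ha with rfl | ha
        · exact ht
        · exact hv a ha
      · rw [List.prod_cons, List.prod_cons, QuotientGroup.mk_mul, hvp]
  obtain ⟨v, hv, hvp, hvl⟩ := key w hw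
  exact ⟨v.prod, hvp.trans hwq, (wordLength_le hv).trans (hvl.trans hwl).le⟩

/-- Balls of the word metric of a finite generating set are finite. -/
theorem finite_wordLength_le (hS : Subgroup.closure S = ⊤) (hfin : S.Finite) (R : ℕ) :
    {g : Γ | wordLength S g ≤ R}.Finite := by
  have : Finite {s : Γ // s ∈ S ∨ s⁻¹ ∈ S} := (hfin.union hfin.inv).to_subtype
  refine ((List.finite_length_le {s : Γ // s ∈ S ∨ s⁻¹ ∈ S} R).image
    fun w => (w.map Subtype.val).prod).subset fun g hg => ?_
  obtain ⟨w, hw, hwg, hwl⟩ := exists_word hS g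
  lift w to List {s : Γ // s ∈ S ∨ s⁻¹ ∈ S} using hw
  rw [List.length_map] at hwl
  exact ⟨w, hwl.trans_le hg, hwg⟩

/-- In a left-invariant metric, right multiplication by `a` moves every point by exactly the length
of `a`. -/
theorem wordDist_mul_mul_le {Q : Type*} [Group Q] {S : Set Q} (hS : Subgroup.closure S = ⊤)
    (x y a b : Q) :
    wordDist S (x * a) (y * b) ≤ wordDist S x y + (wordLength S a + wordLength S b) := by
  have h1 := wordLength_mul_le hS (a⁻¹ * (x⁻¹ * y)) b
  have h2 := wordLength_mul_le hS a⁻¹ (x⁻¹ * y)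
  rw [wordLength_inv hS] at h2
  have h3 : (x * a)⁻¹ * (y * b) = a⁻¹ * (x⁻¹ * y) * b := by group
  rw [wordDist, wordDist, h3]
  omega

theorem wordDist_le_mul_mul {Q : Type*} [Group Q] {S : Set Q} (hS : Subgroup.closure S = ⊤)
    (x y a b : Q) :
    wordDist S x y ≤ wordDist S (x * a) (y * b) + (wordLength S a + wordLength S b) := by
  simpa [wordLength_inv hS] using wordDist_mul_mul_le hS (x * a) (y * b) a⁻¹ b⁻¹

end WordLength

/-! ### Cosets of `H` in the quotients of `Γ`. -/

section Extension

variable {H Γ G : Type*} [Group H] [Group Γ] [Group G] (E : GroupExtension H Γ G)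

/-- The image of `H` in the quotient `Γ ⧸ N`. -/
def imageSubgroup (N : Subgroup Γ) [N.Normal] : Subgroup (Γ ⧸ N) :=
  E.inl.range.map (QuotientGroup.mk' N)

/-- Both conditions say that `g` lies in `H N`. -/
theorem mk_mem_imageSubgroup {N : Subgroup Γ} [N.Normal] {g : Γ} :
    (g : Γ ⧸ N) ∈ imageSubgroup E N ↔ E.rightHom g ∈ quotSubgroup E N := by
  have h : (g : Γ ⧸ N) ∈ imageSubgroup E N ↔ g ∈ E.inl.range ⊔ N := by
    have := Subgroup.comap_map_eq (QuotientGroup.mk' N) E.inl.range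
    rw [QuotientGroup.ker_mk'] at this
    rw [← this]
    rfl
  have h' := Subgroup.comap_map_eq E.rightHom (E.inl.range ⊔ N)
  rw [← E.range_inl_eq_ker_rightHom, sup_right_comm, sup_idem] at h'
  rw [h, ← h']
  rfl

variable {K : ℕ → Subgroup Γ} [∀ i, (K i).Normal]

/-- The homomorphism from `Γ` to `G ⧸ L`. -/
def toLimitQuotient (K : ℕ → Subgroup Γ) [∀ i, (K i).Normal] : Γ →* G ⧸ limitSubgroup E K :=
  (QuotientGroup.mk' (limitSubgroup E K)).comp E.rightHom

theorem toLimitQuotient_surjective : Function.Surjective (toLimitQuotient E K) :=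
  (QuotientGroup.mk'_surjective _).comp E.rightHom_surjective

theorem toLimitQuotient_eq_one {g : Γ} :
    toLimitQuotient E K g = 1 ↔ ∀ i, (g : Γ ⧸ K i) ∈ imageSubgroup E (K i) := by
  simp only [mk_mem_imageSubgroup, ← Subgroup.mem_iInf]
  exact QuotientGroup.eq_one_iff _

theorem imageSubgroup_anti (hK : Antitone K) {g : Γ} {i j : ℕ} (hij : i ≤ j)
    (h : (g : Γ ⧸ K j) ∈ imageSubgroup E (K j)) : (g : Γ ⧸ K i) ∈ imageSubgroup E (K i) := by
  rw [mk_mem_imageSubgroup] at h ⊢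
  exact Subgroup.map_mono (sup_le_sup_left (hK hij) _) h

/-- A map on the box space of `H` extends to the cosets of `H` in the quotients of `Γ`. -/
theorem exists_coset_extension (D : BoxChoice K) {V : Type*} (F : InducedBoxSpace E D → V) :
    ∃ u : ∀ i, Γ ⧸ K i → V, ∀ i x y, x⁻¹ * y ∈ imageSubgroup E (K i) →
      ∃ a b, u i x = F a ∧ u i y = F b ∧ dist a b = D.quotDist i x y := by
  -- Here `s i x` is a chosen representative of the coset of `x`, and `u` is `F` at `s⁻¹ x`. Points
  -- of one coset share it, so left invariance preserves their distance.
  let s : ∀ i, Γ ⧸ K i → Γ ⧸ K i := fun i x =>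
    (QuotientGroup.mk x : (Γ ⧸ K i) ⧸ imageSubgroup E (K i)).out
  have hs : ∀ i (x : Γ ⧸ K i), ∃ h : H, ((E.inl h : Γ) : Γ ⧸ K i) = (s i x)⁻¹ * x := by
    intro i x
    have : (s i x)⁻¹ * x ∈ imageSubgroup E (K i) := QuotientGroup.eq.1 (Quotient.out_eq _)
    obtain ⟨_, ⟨h, rfl⟩, hx⟩ := this
    exact ⟨h, hx⟩
  choose h hh using hs
  refine ⟨fun i x => F ⟨i, (h i x : H)⟩, fun i x y hxy => ⟨_, _, rfl, rfl, ?_⟩⟩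
  have hsxy : s i x = s i y := congrArg Quotient.out (QuotientGroup.eq.2 hxy)
  change D.boxDist ⟨i, ((E.inl (h i x) : Γ) : Γ ⧸ K i)⟩ ⟨i, ((E.inl (h i y) : Γ) : Γ ⧸ K i)⟩ = _
  rw [D.boxDist_same, hh, hh, hsxy, BoxChoice.quotDist, BoxChoice.quotDist, wordDist, wordDist]
  congr 2
  group

end Extension

/-! ### Kernels from a Følner set and the embedding for `H`. -/

section Extension

variable {H Γ G : Type*} [Group H] [Group Γ] [Group G] (E : GroupExtension H Γ G)
  {K : ℕ → Subgroup Γ} [∀ i, (K i).Normal]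

/-- Finitely many elements of `G ⧸ L` stay distinct in almost all quotients `Γ ⧸ H K i`. -/
theorem exists_injective_index (hK : Antitone K) (σ : G ⧸ limitSubgroup E K → Γ)
    (hσ : ∀ q, toLimitQuotient E K (σ q) = q) (A : Finset (G ⧸ limitSubgroup E K)) :
    ∃ n : ℕ, ∀ i, n ≤ i → ∀ a ∈ A, ∀ b ∈ A,
      (((σ a)⁻¹ * σ b : Γ) : Γ ⧸ K i) ∈ imageSubgroup E (K i) → a = b := by
  have h : ∀ p : (G ⧸ limitSubgroup E K) × (G ⧸ limitSubgroup E K), ∃ n : ℕ, ∀ i, n ≤ i →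
      (((σ p.1)⁻¹ * σ p.2 : Γ) : Γ ⧸ K i) ∈ imageSubgroup E (K i) → p.1 = p.2 := by
    intro p
    by_contra! hn
    obtain ⟨i, -, -, hne⟩ := hn 0
    refine hne (inv_mul_eq_one.1 ?_)
    rw [← hσ p.1, ← hσ p.2, ← map_inv, ← map_mul, toLimitQuotient_eq_one]
    -- A failure at arbitrarily large indices descends by nestedness to every index, so the quotient
    -- of the two lifts maps into `L`.
    intro j
    obtain ⟨i, hij, hi, -⟩ := hn j
    exact imageSubgroup_anti E hK hij hi
  choose n hn using h
  exact ⟨(A ×ˢ A).sup n, fun i hi a ha b hb => hn (a, b) i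
    ((Finset.le_sup (f := n) (Finset.mk_mem_product ha hb)).trans hi)⟩

open scoped Pointwise in
open Classical in
-- The excluded elements lie in `A \ g A`. The count gives the `a` that have a partner `g⁻¹ a` in
-- `A`.
theorem card_inter_ge {Q : Type*} [Group Q] (A : Finset Q) (g : Q) {ε : ℝ}
    (h : ((symmDiff (g • A) A).card : ℝ) ≤ ε * A.card) :
    (1 - ε) * A.card ≤ (A.filter fun a => g⁻¹ * a ∈ A).card := by
  have h1 : A.filter (fun a => ¬ g⁻¹ * a ∈ A) ⊆ symmDiff (g • A) A := by
    intro a ha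
    rw [Finset.mem_filter] at ha
    rw [Finset.mem_symmDiff]
    refine Or.inr ⟨ha.1, fun h => ha.2 ?_⟩
    rwa [← Finset.inv_smul_mem_iff] at h
  have h2 := Finset.card_le_card h1
  have h3 := Finset.card_filter_add_card_filter_not (s := A) (fun a => g⁻¹ * a ∈ A)
  have h2' : ((A.filter (fun a => ¬ g⁻¹ * a ∈ A)).card : ℝ) ≤ (symmDiff (g • A) A).card := by
    exact_mod_cast h2
  have h3' : ((A.filter (fun a => g⁻¹ * a ∈ A)).card : ℝ) +
      (A.filter (fun a => ¬ g⁻¹ * a ∈ A)).card = A.card := by exact_mod_cast h3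
  linarith

open Classical in
/-- The Gaussian kernel of a map `u`, restricted to pairs in the same coset of `N`. -/
noncomputable def cosetKernel {Q V : Type*} [Group Q] [NormedAddCommGroup V] (N : Subgroup Q)
    (t : ℝ) (u : Q → V) (x y : Q) : ℝ :=
  if (QuotientGroup.mk x : Q ⧸ N) = QuotientGroup.mk y then Real.exp (-(t * ‖u x - u y‖ ^ 2))
  else 0

theorem isPosKernel_cosetKernel {Q V : Type*} [Group Q] [Fintype Q] [NormedAddCommGroup V]
    [InnerProductSpace ℝ V] (N : Subgroup Q) {t : ℝ} (ht : 0 ≤ t) (u : Q → V) :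
    IsPosKernel (cosetKernel N t u) := by
  classical
  exact (isPosKernel_gaussian u ht).blocks (QuotientGroup.mk : Q → Q ⧸ N)

theorem cosetKernel_nonneg {Q V : Type*} [Group Q] [NormedAddCommGroup V] (N : Subgroup Q)
    (t : ℝ) (u : Q → V) (x y : Q) : 0 ≤ cosetKernel N t u x y := by
  unfold cosetKernel
  split_ifs
  · positivity
  · exact le_rfl

theorem cosetKernel_of_mem {Q V : Type*} [Group Q] [NormedAddCommGroup V] {N : Subgroup Q}
    {t : ℝ} {u : Q → V} {x y : Q} (h : x⁻¹ * y ∈ N) :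
    cosetKernel N t u x y = Real.exp (-(t * ‖u x - u y‖ ^ 2)) :=
  if_pos (QuotientGroup.eq.2 h)

theorem cosetKernel_of_notMem {Q V : Type*} [Group Q] [NormedAddCommGroup V] {N : Subgroup Q}
    {t : ℝ} {u : Q → V} {x y : Q} (h : x⁻¹ * y ∉ N) : cosetKernel N t u x y = 0 :=
  if_neg fun h' => h (QuotientGroup.eq.1 h')

/-- Positive kernels on the quotients `Γ ⧸ K i` built from a Følner set of `G ⧸ L` and a coarse
embedding of the box space of `H`. -/
theorem exists_kernels [∀ i, Fintype (Γ ⧸ K i)] (hK : Antitone K) (D : BoxChoice K)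
    (hamenable : IsAmenable (G ⧸ limitSubgroup E K))
    (hH : CoarselyEmbedsIntoHilbert (InducedBoxSpace E D)) (R : ℕ) {ε : ℝ} (hε : 0 < ε) :
    ∃ Φ : ∀ i, Γ ⧸ K i → Γ ⧸ K i → ℝ, (∀ i, IsPosKernel (Φ i)) ∧
      (∀ i x, Φ i x x = 1) ∧ (∀ i x y, 0 ≤ Φ i x y) ∧
      (∀ i x y, wordDist (quotGen (D.gen : Set Γ) (K i)) x y ≤ R → 1 - ε ≤ Φ i x y) ∧
      ∃ S : ℕ, ∀ i x y, S ≤ wordDist (quotGen (D.gen : Set Γ) (K i)) x y →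
        Φ i x y ≤ 1 / 2 := by
  classical
  obtain ⟨F, ρ₁, ρ₂, hρ₁, hρ₂, hρ₁', -, hF⟩ := hH
  obtain ⟨u, hu⟩ := exists_coset_extension E D F
  set π := toLimitQuotient E K with hπ
  have hS := D.closure_gen
  have hSi := fun i => closure_quotGen D.closure_gen (K i)
  have hball := finite_wordLength_le hS D.gen.finite_toSet R
  -- Half of `ε` pays for the Følner defect, the other half for the Gaussian.
  obtain ⟨A, hA, hAT⟩ := hamenable (hball.toFinset.image π) (ε / 2) (by positivity)
  have hn : (0 : ℝ) < A.card := by exact_mod_cast hA.card_pos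
  set σ := Function.surjInv (toLimitQuotient_surjective E (K := K)) with hσdef
  have hσ : ∀ q, π (σ q) = q := Function.surjInv_eq _
  obtain ⟨n, hinj⟩ := exists_injective_index E hK σ hσ A
  -- Translating both arguments by lifts changes distances by at most `2 * C`.
  set C := A.sup fun a => wordLength (D.gen : Set Γ) (σ a) with hC
  have hCle : ∀ i, ∀ a : A,
      wordLength (quotGen (D.gen : Set Γ) (K i)) (σ a : Γ ⧸ K i) ≤ C := fun i a =>
    (wordLength_mk_le hS _ _).trans (Finset.le_sup (f := fun a => wordLength _ (σ a)) a.2)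
  have hupper : ∀ i x y, x⁻¹ * y ∈ imageSubgroup E (K i) →
      ∀ r : ℕ, wordDist (quotGen (D.gen : Set Γ) (K i)) x y ≤ r → ‖u i x - u i y‖ ≤ ρ₂ r := by
    intro i x y hxy r hr
    obtain ⟨a, b, ha, hb, hab⟩ := hu i x y hxy
    rw [ha, hb, ← dist_eq_norm]
    have h1 := (hF a b).2.trans (hρ₂ (b := (r : ℝ≥0)) (by
      rw [← NNReal.coe_le_coe, coe_nndist, hab, BoxChoice.quotDist]
      exact_mod_cast hr))
    exact_mod_cast h1
  have hlower : ∀ i x y, x⁻¹ * y ∈ imageSubgroup E (K i) →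
      ∀ r : ℕ, r ≤ wordDist (quotGen (D.gen : Set Γ) (K i)) x y → ρ₁ r ≤ ‖u i x - u i y‖ := by
    intro i x y hxy r hr
    obtain ⟨a, b, ha, hb, hab⟩ := hu i x y hxy
    rw [ha, hb, ← dist_eq_norm]
    have h1 := (hρ₁ (a := (r : ℝ≥0)) (by
      rw [← NNReal.coe_le_coe, coe_nndist, hab, BoxChoice.quotDist]
      exact_mod_cast hr)).trans (hF a b).1
    exact_mod_cast h1
  obtain ⟨t, ht, htε⟩ : ∃ t : ℝ, 0 < t ∧ t * (ρ₂ (R + 2 * C : ℕ) : ℝ) ^ 2 ≤ ε / 2 := by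
    refine ⟨ε / 2 / ((ρ₂ (R + 2 * C : ℕ) : ℝ) ^ 2 + 1), by positivity, ?_⟩
    rw [div_mul_eq_mul_div, div_le_iff₀ (by positivity)]
    nlinarith
  -- There are `|A| ^ 2` terms and a factor `|A|⁻¹`, so the bound `1 / (2 |A|)` per term gives `1/2`
  -- in total.
  obtain ⟨s, hs⟩ : ∃ s : ℕ, Real.exp (-(t * (ρ₁ s : ℝ) ^ 2)) ≤ 1 / (2 * A.card) := by
    have h1 : Filter.Tendsto (fun s : ℕ => (ρ₁ s : ℝ)) Filter.atTop Filter.atTop :=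
      NNReal.tendsto_coe_atTop.2 (hρ₁'.comp tendsto_natCast_atTop_atTop)
    have h2 : Filter.Tendsto (fun s : ℕ => Real.exp (-(t * (ρ₁ s : ℝ) ^ 2))) Filter.atTop
        (nhds 0) :=
      Real.tendsto_exp_neg_atTop_nhds_zero.comp
        (((Filter.tendsto_pow_atTop two_ne_zero).comp h1).const_mul_atTop ht)
    exact (h2.eventually_le_const (by positivity)).exists
  set κ := fun i => cosetKernel (imageSubgroup E (K i)) t (u i) with hκ
  set Θ : ∀ i, Γ ⧸ K i → Γ ⧸ K i → ℝ := fun i x y =>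
    (A.card : ℝ)⁻¹ * ∑ a : A, ∑ b : A, κ i (x * (σ a : Γ)) (y * (σ b : Γ)) with hΘ
  have hΘpos : ∀ i, IsPosKernel (Θ i) := fun i =>
    ((isPosKernel_cosetKernel _ ht.le (u i)).sum_sum
      fun (a : A) x => x * ((σ a : Γ) : Γ ⧸ K i)).const_mul (by positivity)
  have hΘnn : ∀ i x y, 0 ≤ Θ i x y := fun i x y =>
    mul_nonneg (by positivity) (Finset.sum_nonneg fun a _ => Finset.sum_nonneg fun b _ =>
      cosetKernel_nonneg _ _ _ _ _)
  have hΘone : ∀ i, n ≤ i → ∀ x, Θ i x x = 1 := by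
    intro i hi x
    have h : ∀ a b : A, κ i (x * (σ a : Γ)) (x * (σ b : Γ)) = if a = b then 1 else 0 := by
      intro a b
      split_ifs with hab
      · subst hab
        simp only [hκ]
        rw [cosetKernel_of_mem (by simp [one_mem])]
        simp
      · refine cosetKernel_of_notMem fun h => hab (Subtype.ext (hinj i hi a a.2 b b.2 ?_))
        convert h using 1
        rw [QuotientGroup.mk_mul, QuotientGroup.mk_inv]
        group
    simp only [hΘ, h, Finset.sum_ite_eq, Finset.mem_univ, if_true, Finset.sum_const,
      Finset.card_univ, Fintype.card_coe, nsmul_eq_mul, mul_one]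
    exact inv_mul_cancel₀ hn.ne'
  have hΘvar : ∀ i x y, wordDist (quotGen (D.gen : Set Γ) (K i)) x y ≤ R → 1 - ε ≤ Θ i x y := by
    intro i x y hxy
    obtain ⟨g, hg, hgl⟩ := exists_lift_wordLength_le hS (K i) (x⁻¹ * y)
    have hgR : wordLength (D.gen : Set Γ) g ≤ R := hgl.trans hxy
    set I := A.filter fun a => (π g)⁻¹ * a ∈ A with hI
    have hcard : (1 - ε / 2) * A.card ≤ (I.card : ℝ) := by
      convert card_inter_ge A (π g) (hAT (π g)
        (Finset.mem_image_of_mem _ (hball.mem_toFinset.2 hgR)))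
    have hIA : (I.card : ℝ) ≤ A.card := by exact_mod_cast Finset.card_filter_le _ _
    have hterm : ∀ a : A, (if (π g)⁻¹ * a ∈ A then 1 - ε / 2 else 0) ≤
        ∑ b : A, κ i (x * (σ a : Γ)) (y * (σ b : Γ)) := by
      intro a
      split_ifs with ha
      · refine le_trans ?_ (Finset.single_le_sum (f := fun b : A =>
          κ i (x * (σ a : Γ)) (y * (σ b : Γ))) (fun b _ => cosetKernel_nonneg _ _ _ _ _)
          (Finset.mem_univ (⟨_, ha⟩ : A)))
        -- With `b = (π g)⁻¹ a`, the element `(σ a)⁻¹ g σ b` is trivial in `G ⧸ L`, so `x σ a` and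
        -- `y σ b` share a coset for every `i`.
        have hmem : (x * (σ a : Γ))⁻¹ * (y * (σ ((π g)⁻¹ * a) : Γ)) ∈
            imageSubgroup E (K i) := by
          have h1 := (toLimitQuotient_eq_one E (K := K)
            (g := (σ a)⁻¹ * g * σ ((π g)⁻¹ * a))).1 (by
              rw [map_mul, map_mul, map_inv, ← hπ, hσ, hσ]; group) i
          rw [QuotientGroup.mk_mul, QuotientGroup.mk_mul, QuotientGroup.mk_inv, hg] at h1
          convert h1 using 1
          group
        simp only [hκ]
        rw [cosetKernel_of_mem hmem]
        have h2 := hupper i _ _ hmem (R + 2 * C) (by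
          have h3 := wordDist_mul_mul_le (hSi i) x y (σ a : Γ) (σ ((π g)⁻¹ * a) : Γ)
          have h4 := hCle i a
          have h5 := hCle i ⟨_, ha⟩
          simp only at h5
          omega)
        have h3 : t * ‖u i (x * (σ a : Γ)) - u i (y * (σ ((π g)⁻¹ * a) : Γ))‖ ^ 2 ≤ ε / 2 :=
          le_trans (by gcongr) htε
        have h4 := Real.add_one_le_exp
          (-(t * ‖u i (x * (σ a : Γ)) - u i (y * (σ ((π g)⁻¹ * a) : Γ))‖ ^ 2))
        linarith
      · exact Finset.sum_nonneg fun b _ => cosetKernel_nonneg _ _ _ _ _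
    have hsum := Finset.sum_le_sum fun (a : A) (_ : a ∈ Finset.univ) => hterm a
    rw [Finset.sum_coe_sort A fun a => if (π g)⁻¹ * a ∈ A then 1 - ε / 2 else (0 : ℝ),
      ← Finset.sum_filter, Finset.sum_const, nsmul_eq_mul, ← hI] at hsum
    rw [hΘ]
    dsimp only
    rw [inv_mul_eq_div, le_div_iff₀ hn]
    refine le_trans ?_ hsum
    -- Write `|I| (1 - ε / 2)` as `|I| - (ε / 2) |I|` and use `|I| ≤ |A|` in the second term; `1 - ε
    -- / 2` may be negative.
    nlinarith
  have hΘdec : ∀ i x y, s + 2 * C ≤ wordDist (quotGen (D.gen : Set Γ) (K i)) x y →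
      Θ i x y ≤ 1 / 2 := by
    intro i x y hxy
    have hterm : ∀ a b : A, κ i (x * (σ a : Γ)) (y * (σ b : Γ)) ≤ 1 / (2 * A.card) := by
      intro a b
      by_cases hmem : (x * (σ a : Γ))⁻¹ * (y * (σ b : Γ)) ∈ imageSubgroup E (K i)
      · simp only [hκ]
        rw [cosetKernel_of_mem hmem]
        refine le_trans ?_ hs
        have h1 := hlower i _ _ hmem s (by
          have h3 := wordDist_le_mul_mul (hSi i) x y (σ a : Γ) (σ b : Γ)
          have h4 := hCle i a
          have h5 := hCle i b
          omega)
        gcongr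
      · simp only [hκ]
        rw [cosetKernel_of_notMem hmem]
        positivity
    have h1 := Finset.sum_le_sum fun (a : A) (_ : a ∈ Finset.univ) =>
      Finset.sum_le_sum fun (b : A) (_ : b ∈ Finset.univ) => hterm a b
    simp only [Finset.sum_const, Finset.card_univ, Fintype.card_coe, nsmul_eq_mul] at h1
    rw [hΘ]
    dsimp only
    rw [inv_mul_eq_div, div_le_iff₀ hn]
    refine h1.trans_eq ?_
    field_simp
  refine ⟨fun i x y => if i < n then 1 else Θ i x y, fun i => ?_, fun i x => ?_, fun i x y => ?_,
    fun i x y hxy => ?_, ?_⟩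
  · by_cases hi : i < n
    · simpa only [hi, if_true] using isPosKernel_one
    · simpa only [hi, if_false] using hΘpos i
  · dsimp only
    split_ifs with hi
    · rfl
    · exact hΘone i (not_lt.1 hi) x
  · dsimp only
    split_ifs
    · exact zero_le_one
    · exact hΘnn i x y
  · dsimp only
    split_ifs
    · linarith
    · exact hΘvar i x y hxy
  -- `m` bounds the diameters of the first `n` quotients, so pairs at distance at least `m` occur
  -- only where the kernel is `Θ`.
  · obtain ⟨m, hm⟩ := exists_nat_ge (∑ i ∈ Finset.range n, D.gap i)
    refine ⟨max m (s + 2 * C), fun i x y hxy => ?_⟩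
    dsimp only
    rw [if_neg]
    · exact hΘdec i x y ((le_max_right _ _).trans hxy)
    · intro hi
      have h1 := D.dist_lt_gap i x y
      have h2 := Finset.single_le_sum (f := D.gap) (fun k _ => (D.gap_pos k).le)
        (Finset.mem_range.2 hi)
      have h3 : (m : ℝ) ≤ wordDist (quotGen (D.gen : Set Γ) (K i)) x y := by
        exact_mod_cast (le_max_left _ _).trans hxy
      linarith

end Extension

end BoxSpaces

/-! ### The main theorem. -/

theorem mainTheorem5 {H Γ G : Type*} [Group H] [Group Γ] [Group G]
    (E : GroupExtension H Γ G)
    (K : ℕ → Subgroup Γ) [∀ i, (K i).Normal] [∀ i, (K i).FiniteIndex]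
    (hnested : Antitone K) (htrivial : ⨅ i, K i = ⊥)
    (D : BoxSpaces.BoxChoice K)
    (hamenable : BoxSpaces.IsAmenable (G ⧸ BoxSpaces.limitSubgroup E K))
    (hH : BoxSpaces.CoarselyEmbedsIntoHilbert (BoxSpaces.InducedBoxSpace E D)) :
    BoxSpaces.CoarselyEmbedsIntoHilbert (BoxSpaces.BoxSpace D) := by
  have : ∀ i, Fintype (Γ ⧸ K i) := fun i => Fintype.ofFinite _
  obtain ⟨F, h0, hone, hup, hlow⟩ := BoxSpaces.exists_uniform_embedding (fun i => (1 : Γ ⧸ K i))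
    (fun i => BoxSpaces.wordDist (BoxSpaces.quotGen (D.gen : Set Γ) (K i)))
    fun R _ hε => BoxSpaces.exists_kernels E hnested D hamenable hH R hε
  refine D.coarselyEmbedsIntoHilbert_of_uniform F h0 hone hup fun N => ?_
  obtain ⟨S, hS⟩ := hlow N
  exact ⟨S, fun i x y h => hS i x y (Nat.cast_le.1 h)⟩
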